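/- Let $\langle x\rangle=\sqrt{1+|x|^2}$ for $x\in\mathbb R^3$, let $\sigma_1,\sigma_2,\sigma_3$ be the Pauli matrices, let $\alpha_j=\begin{pmatrix}0&\sigma_j\\ \sigma_j&0\end{pmatrix}$ $(j=1,2,3)$ be the $4\times4$ Dirac matrices, and consider the massless Dirac operator $$H=\alpha\cdot D+Q(x)=\sum_{j=1}^3\alpha_j\,\frac1i\,\frac{\partial}{\partial x_j}+Q(x),\qquad x\in\mathbb R^3 .$$ For $\sigma\in\mathbb R$ let $\mathcal L^{2,\sigma}$ be the space of functions $f:\mathbb R^3\to\mathbb C^4$ with $\langle x\rangle^{\sigma}f\in\mathcal L^2=[L^2(\mathbb R^3)]^4$, and let $\mathcal H^1=[H^1(\mathbb R^3)]^4$ be the Sobolev space of order $1$. Theorem. Let $\rho>3/2$, and let $Q(x)=(q_{jk}(x))$ be a $4\times4$ Hermitian matrix for each $x\in\mathbb R^3$, with measurable entries satisfying $|q_{jk}(x)|\le C\langle x\rangle^{-\rho}$ for all $x$, $j$, $k$, where $C$ is a positive constant. If $f\in\mathcal L^{2,-s}$ for some $s$ with $0<s\le\min\{3/2,\rho-1\}$,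 and $Hf=0$ in the distributional sense, then $f\in\mathcal H^1$. In particular, $H$ has no zero resonances with weight exponent in this range: there is no $s$ with $0<s\le\min\{3/2,\rho-1\}$ and no $f\in\mathcal L^{2,-s}\setminus\mathcal L^2$ such that $Hf=0$ in the distributional sense. -/

import Mathlib

open MeasureTheory TemperedDistribution
open scoped SchwartzMap LineDeriv

noncomputable section

/-- The physical space `ℝ³`, with its Euclidean norm. -/
abbrev R3 : Type := EuclideanSpace ℝ (Fin 3)

/-- The space `ℂ⁴` of four-component spinors, with its Hermitian norm. -/
abbrev C4 : Type := EuclideanSpace ℂ (Fin 4)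

/-- The Japanese bracket `⟨x⟩ = √(1 + |x|²)`. -/
def bracket (x : R3) : ℝ := √(1 + ‖x‖ ^ 2)

/-- The Pauli matrices `σ₁, σ₂, σ₃`. -/
def pauli : Fin 3 → Matrix (Fin 2) (Fin 2) ℂ :=
  ![!![0, 1; 1, 0], !![0, -Complex.I; Complex.I, 0], !![1, 0; 0, -1]]

/-- The Dirac matrices, with blocks `0, σⱼ; σⱼ, 0`. -/
def diracAlpha (j : Fin 3) : Matrix (Fin 4) (Fin 4) ℂ :=
  Matrix.reindex finSumFinEquiv finSumFinEquiv (Matrix.fromBlocks 0 (pauli j) (pauli j) 0)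

/-- The standing assumption on the potential `Q`: its entries are (Lebesgue) measurable functions
bounded by `C ⟨x⟩ ^ (-ρ)` for some constant `C > 0`, with `ρ > 1`, and all its values are
Hermitian matrices. -/
structure PotentialAssumption (Q : R3 → Matrix (Fin 4) (Fin 4) ℂ) (ρ : ℝ) : Prop where
  one_lt : 1 < ρ
  aemeasurable : ∀ j k, AEMeasurable (fun x => Q x j k) volume
  decay : ∃ C : ℝ, 0 < C ∧ ∀ x j k, ‖Q x j k‖ ≤ C * bracket x ^ (-ρ)
  isHermitian : ∀ x, (Q x).IsHermitian

/-- The weighted space `𝓛^{2,σ} = [L^{2,σ}(ℝ³)]⁴`: `⟨x⟩ ^ σ f` is square integrable. -/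
def MemWeightedL2 (σ : ℝ) (f : R3 → C4) : Prop :=
  MemLp (fun x => (bracket x ^ σ) • f x) 2 volume

/-- The pointwise product `(Q f)(x) = Q(x) f(x)`. -/
def potentialMul (Q : R3 → Matrix (Fin 4) (Fin 4) ℂ) (f : R3 → C4) : R3 → C4 :=
  fun x => Matrix.toEuclideanCLM (n := Fin 4) (𝕜 := ℂ) (Q x) (f x)

theorem bracket_pos (x : R3) : 0 < bracket x := by
  unfold bracket; positivity

theorem one_le_bracket (x : R3) : 1 ≤ bracket x := by
  unfold bracket
  rw [Real.one_le_sqrt]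
  nlinarith [sq_nonneg ‖x‖]

theorem hasTemperateGrowth_bracket_rpow (σ : ℝ) :
    (fun x : R3 => ((bracket x ^ σ : ℝ) : ℂ)).HasTemperateGrowth := by
  have h : (fun x : R3 => bracket x ^ σ) = fun x : R3 => (1 + ‖x‖ ^ 2) ^ (σ / 2) := by
    funext x
    rw [bracket, Real.sqrt_eq_rpow, ← Real.rpow_mul (by positivity)]
    congr 1; ring
  have h2 : (fun x : R3 => ((bracket x ^ σ : ℝ) : ℂ))
      = fun x : R3 => (((1 + ‖x‖ ^ 2) ^ (σ / 2) : ℝ) : ℂ) := by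
    funext x; exact congrArg _ (congrFun h x)
  rw [h2]
  fun_prop

/-- A function `f ∈ 𝓛^{2,σ}`, regarded as an element of `𝓢'`: it is
`⟨x⟩ ^ (-σ)` times the `L²` function `⟨x⟩ ^ σ f`. -/
def MemWeightedL2.toDist {σ : ℝ} {f : R3 → C4} (hf : MemWeightedL2 σ f) : 𝓢'(R3, C4) :=
  smulLeftCLM C4 (fun x => ((bracket x ^ (-σ) : ℝ) : ℂ))
    (MemLp.toLp _ hf : Lp C4 2 (volume : Measure R3))

/-- The distribution attached to `f` is `φ ↦ ∫ φ f`. -/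
theorem MemWeightedL2.toDist_apply {σ : ℝ} {f : R3 → C4} (hf : MemWeightedL2 σ f)
    (φ : 𝓢(R3, ℂ)) : hf.toDist φ = ∫ x, φ x • f x := by
  have hg := hasTemperateGrowth_bracket_rpow (-σ)
  rw [MemWeightedL2.toDist, TemperedDistribution.smulLeftCLM_apply_apply, Lp.toTemperedDistribution_apply]
  apply integral_congr_ae
  filter_upwards [MemLp.coeFn_toLp hf] with x hx
  rw [hx, SchwartzMap.smulLeftCLM_apply_apply hg, ← Complex.coe_smul, smul_smul]
  congr 1
  rw [smul_eq_mul, mul_right_comm, ← Complex.ofReal_mul,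
    ← Real.rpow_add (bracket_pos x), neg_add_cancel, Real.rpow_zero]
  simp

/-- If `f ∈ 𝓛^{2,σ}` then `Q f ∈ 𝓛^{2,σ}`, so that `Q f` is a tempered distribution as well. -/
theorem MemWeightedL2.potentialMul {Q : R3 → Matrix (Fin 4) (Fin 4) ℂ} {ρ : ℝ}
    (hQ : PotentialAssumption Q ρ) {σ : ℝ} {f : R3 → C4} (hf : MemWeightedL2 σ f) :
    MemWeightedL2 σ (potentialMul Q f) := by
  obtain ⟨C, hC, hd⟩ := hQ.decay
  have hb : ∀ x j k, ‖Q x j k‖ ≤ C := fun x j k => (hd x j k).trans <|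
    mul_le_of_le_one_right hC.le
      (Real.rpow_le_one_of_one_le_of_nonpos (one_le_bracket x) (by linarith [hQ.one_lt]))
  have hcoord := memLp_piLp_iff.1 hf
  refine memLp_piLp_iff.2 fun j => ?_
  have hsum : MemLp (fun x => ∑ k, Q x j k * (bracket x ^ σ • f x) k) 2 volume := by
    refine memLp_finsetSum _ fun k _ => ?_
    refine (hcoord k).of_le_mul (c := C) ?_ (Filter.Eventually.of_forall fun x => ?_)
    · exact (hQ.aemeasurable j k).aestronglyMeasurable.mul (hcoord k).1
    · rw [norm_mul]
      exact mul_le_mul_of_nonneg_right (hb x j k) (norm_nonneg _)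
  convert hsum using 2 with x
  simp [_root_.potentialMul, Matrix.mulVec, dotProduct, Finset.mul_sum, mul_left_comm]

/-- The free Dirac operator `α · D = ∑ⱼ αⱼ (1/i) ∂ⱼ` on `𝓢'`. -/
def freeDirac (u : 𝓢'(R3, C4)) : 𝓢'(R3, C4) :=
  ∑ j : Fin 3, PointwiseConvergenceCLM.postcomp _
    (Matrix.toEuclideanCLM (n := Fin 4) (𝕜 := ℂ) (diracAlpha j))
    ((1 / Complex.I) • ∂_{EuclideanSpace.single j (1 : ℝ)} u)

/-- `H f = (α · D) f + Q f` in the distributional sense, for `f ∈ 𝓛^{2,σ}`. -/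
def diracDist {Q : R3 → Matrix (Fin 4) (Fin 4) ℂ} {ρ : ℝ} (hQ : PotentialAssumption Q ρ)
    {σ : ℝ} {f : R3 → C4} (hf : MemWeightedL2 σ f) : 𝓢'(R3, C4) :=
  freeDirac hf.toDist + (hf.potentialMul hQ).toDist

/-- The Sobolev space `𝓗¹ = [H¹(ℝ³)]⁴` of functions in some `𝓛^{2,σ}`:
`⟨D⟩ f ∈ 𝓛²`, where `⟨D⟩ f` is taken in `𝓢'`. -/
def MemWeightedL2.MemH1 {σ : ℝ} {f : R3 → C4} (hf : MemWeightedL2 σ f) : Prop :=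
  MemSobolev 1 2 hf.toDist

/-- Zero resonances with weight exponent `s`: functions `f ∈ 𝓛^{2,-s} ∖ 𝓛²` with `H f = 0` in the
distributional sense. -/
def IsZeroResonance {Q : R3 → Matrix (Fin 4) (Fin 4) ℂ} {ρ : ℝ} (hQ : PotentialAssumption Q ρ)
    (s : ℝ) (f : R3 → C4) : Prop :=
  ∃ hf : MemWeightedL2 (-s) f, ¬ MemLp f 2 volume ∧ diracDist hQ hf = 0

end

/-! The Dirac matrices satisfy the Clifford relations, so `(α · D)² = -Δ`. Transposed onto a
Schwartz function `v`, the equation `Hf = 0` becomes `⟨f, Δv⟩ = i ∑ αₖ ⟨Qf, ∂ₖv⟩`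
(`apply_laplacian_of_freeDirac_add_eq_zero`). Given a test function `φ`, take the Schwartz solution
`v` of `(ε² - (2π)⁻²Δ)v = φ`. Then `⟨f, φ⟩ = ε²⟨f, v⟩ - (2π)⁻² i ∑ αₖ ⟨Qf, ∂ₖv⟩`.

The second term is bounded by a multiple of `‖φ‖₂` uniformly in `ε`: `s ≤ ρ - 1` puts `⟨x⟩Qf` in
`L²`, and `hardy_inequality` controls `⟨x⟩⁻¹∂ₖv` by second derivatives of `v`, which Plancherel
bounds by `φ`. The first term is arbitrarily small for suitable `ε` because `s ≤ 3/2`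
(`resolvent_pairing_small`).

Hence `|⟨f, φ⟩| ≤ C‖φ‖₂`, and `f ∈ L²` by density and Riesz representation
(`exists_Lp_eq_of_norm_le`). Finally `Qf ∈ L²` as well, so `Δf`, a combination of first derivatives
of `Qf`, lies in `H⁻¹`, and elliptic regularity gives `f ∈ H¹`. -/

open FourierTransform Laplacian Real

/-! ### The regularised Laplace equation in Schwartz space -/

noncomputable section

/-- The standard basis vectors of `ℝ³`. -/
abbrev stdVec (j : Fin 3) : R3 := EuclideanSpace.single j (1 : ℝ)

theorem inner_stdVec (x : R3) (j : Fin 3) : inner ℝ x (stdVec j) = x j := by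
  simp [EuclideanSpace.inner_single_right]

theorem abs_coord_le_norm (x : R3) (j : Fin 3) : |x j| ≤ ‖x‖ := by
  simpa using PiLp.norm_apply_le x j

theorem sum_coord_sq (x : R3) : ∑ j, x j ^ 2 = ‖x‖ ^ 2 := by
  simp [EuclideanSpace.norm_sq_eq]

theorem laplacian_eq_sum_stdVec (v : 𝓢(R3, ℂ)) :
    Δ v = ∑ j : Fin 3, ∂_{stdVec j} (∂_{stdVec j} v) := by
  rw [SchwartzMap.laplacian_eq_sum (EuclideanSpace.basisFun (Fin 3) ℝ)]
  simp [stdVec]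

theorem fourier_lineDeriv_apply (v : 𝓢(R3, ℂ)) (j : Fin 3) (ξ : R3) :
    𝓕 (∂_{stdVec j} v) ξ = 2 * π * Complex.I * (ξ j : ℂ) * 𝓕 v ξ := by
  have : (fun x : R3 => inner ℝ x (stdVec j)).HasTemperateGrowth := by fun_prop
  rw [SchwartzMap.fourier_lineDerivOp_eq, smul_apply,
    SchwartzMap.smulLeftCLM_apply_apply this, inner_stdVec]
  simp [mul_assoc]

theorem lineDeriv_fourier_eq (v : 𝓢(R3, ℂ)) (j : Fin 3) :
    ∂_{stdVec j} (𝓕 v) = 𝓕 (-(2 * π * Complex.I) •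
      SchwartzMap.smulLeftCLM ℂ (fun x : R3 => x j) v) := by
  have : (fun x : R3 => x j) = fun x : R3 => inner ℝ x (stdVec j) := by
    funext x; rw [inner_stdVec]
  rw [SchwartzMap.lineDerivOp_fourier_eq, this]

theorem integrable_norm_sq (v : 𝓢(R3, ℂ)) : Integrable fun x => ‖v x‖ ^ 2 :=
  (v.memLp 2 volume).integrable_norm_pow (by norm_num)

/-- For `ε > 0` the inverse symbol is a rescaling of `(1 + |y|²)⁻¹`, hence a multiplier of the
Schwartz space; this is what fails at `ε = 0`. -/
theorem hasTemperateGrowth_inv_sq_add_norm_sq {ε : ℝ} (hε : 0 < ε) :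
    (fun ξ : R3 => (ε ^ 2 + ‖ξ‖ ^ 2)⁻¹).HasTemperateGrowth := by
  have h : (fun ξ : R3 => (ε ^ 2 + ‖ξ‖ ^ 2)⁻¹) = fun ξ : R3 => (ε ^ 2)⁻¹ *
      (fun y : R3 => (1 + ‖y‖ ^ 2) ^ (-1 : ℝ)) ((ε⁻¹ • ContinuousLinearMap.id ℝ R3) ξ) := by
    funext ξ
    simp only [smul_apply, ContinuousLinearMap.id_apply, norm_smul, norm_inv,
      Real.norm_eq_abs, abs_of_pos hε]
    rw [Real.rpow_neg_one, ← mul_inv]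
    congr 1
    field_simp
  rw [h]
  refine (Function.HasTemperateGrowth.const _).mul ?_
  exact (Function.hasTemperateGrowth_one_add_norm_sq_rpow R3 (-1)).comp
    (ContinuousLinearMap.hasTemperateGrowth _)

/-- Solvability of `(ε² - (2π)⁻² Δ) v = φ` in the Schwartz space, stated on the Fourier side. -/
theorem exists_resolvent {ε : ℝ} (hε : 0 < ε) (φ : 𝓢(R3, ℂ)) :
    ∃ v : 𝓢(R3, ℂ), ∀ ξ, ((ε ^ 2 + ‖ξ‖ ^ 2 : ℝ) : ℂ) * 𝓕 v ξ = 𝓕 φ ξ := by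
  refine ⟨𝓕⁻ (SchwartzMap.smulLeftCLM ℂ (fun ξ : R3 => (ε ^ 2 + ‖ξ‖ ^ 2)⁻¹) (𝓕 φ)), fun ξ => ?_⟩
  rw [FourierTransform.fourier_fourierInv_eq,
    SchwartzMap.smulLeftCLM_apply_apply (hasTemperateGrowth_inv_sq_add_norm_sq hε)]
  have : ((ε ^ 2 + ‖ξ‖ ^ 2 : ℝ) : ℂ) ≠ 0 := by
    rw [Complex.ofReal_ne_zero]; positivity
  rw [Complex.real_smul, ← mul_assoc, ← Complex.ofReal_mul, mul_inv_cancel₀ (by positivity)]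
  simp

theorem resolvent_equation {ε : ℝ} {v φ : 𝓢(R3, ℂ)}
    (h : ∀ ξ, ((ε ^ 2 + ‖ξ‖ ^ 2 : ℝ) : ℂ) * 𝓕 v ξ = 𝓕 φ ξ) :
    ((ε : ℂ) ^ 2) • v - (((2 * π : ℂ) ^ 2)⁻¹) • Δ v = φ := by
  have hinj : Function.Injective (𝓕 : 𝓢(R3, ℂ) → 𝓢(R3, ℂ)) := fun a b hab => by
    simpa using congrArg (𝓕⁻ : 𝓢(R3, ℂ) → 𝓢(R3, ℂ)) hab
  apply hinj
  ext ξ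
  rw [← h ξ, laplacian_eq_sum_stdVec, sub_eq_add_neg, ← neg_smul, FourierTransform.fourier_add,
    FourierTransform.fourier_smul, FourierTransform.fourier_smul, FourierTransform.fourier_sum]
  simp only [add_apply, smul_apply, sum_apply,
    fourier_lineDeriv_apply, smul_eq_mul]
  rw [← sum_coord_sq, Fin.sum_univ_three, Fin.sum_univ_three]
  have hpi : (π : ℂ) ≠ 0 := by simp [Real.pi_ne_zero]
  push_cast
  field_simp
  ring_nf
  simp only [Complex.I_sq]
  ring

/-- Plancherel, with `|ξⱼ ξₖ| ≤ ε² + |ξ|²`. The constant does not depend on `ε`, which allows `ε →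
0`. -/
theorem integral_norm_sq_deriv_deriv_le {ε : ℝ} {v φ : 𝓢(R3, ℂ)}
    (h : ∀ ξ, ((ε ^ 2 + ‖ξ‖ ^ 2 : ℝ) : ℂ) * 𝓕 v ξ = 𝓕 φ ξ) (j k : Fin 3) :
    ∫ x, ‖∂_{stdVec j} (∂_{stdVec k} v) x‖ ^ 2 ≤ (2 * π) ^ 4 * ∫ x, ‖φ x‖ ^ 2 := by
  rw [← SchwartzMap.integral_norm_sq_fourier, ← SchwartzMap.integral_norm_sq_fourier φ,
    ← integral_const_mul]
  refine integral_mono (integrable_norm_sq _) ((integrable_norm_sq _).const_mul _) fun ξ => ?_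
  simp only [fourier_lineDeriv_apply]
  rw [← h ξ]
  simp only [norm_mul, Complex.norm_real, Complex.norm_I, Complex.norm_ofNat, mul_pow, one_pow,
    Real.norm_eq_abs, sq_abs]
  have hj : ξ j ^ 2 ≤ ‖ξ‖ ^ 2 := sq_le_sq' (by linarith [neg_abs_le (ξ j), abs_coord_le_norm ξ j])
    ((le_abs_self _).trans (abs_coord_le_norm ξ j))
  have hk : ξ k ^ 2 ≤ ‖ξ‖ ^ 2 := sq_le_sq' (by linarith [neg_abs_le (ξ k), abs_coord_le_norm ξ k])
    ((le_abs_self _).trans (abs_coord_le_norm ξ k))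
  have : ξ j ^ 2 * ξ k ^ 2 ≤ (ε ^ 2 + ‖ξ‖ ^ 2) ^ 2 := by
    calc ξ j ^ 2 * ξ k ^ 2 ≤ ‖ξ‖ ^ 2 * ‖ξ‖ ^ 2 := by gcongr
      _ ≤ (ε ^ 2 + ‖ξ‖ ^ 2) ^ 2 := by nlinarith [sq_nonneg ε, sq_nonneg ‖ξ‖, mul_nonneg (sq_nonneg ε) (sq_nonneg ‖ξ‖)]
  calc _ = (2 * π) ^ 4 * ((ξ j ^ 2 * ξ k ^ 2) * ‖𝓕 v ξ‖ ^ 2) := by ring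
    _ ≤ (2 * π) ^ 4 * ((ε ^ 2 + ‖ξ‖ ^ 2) ^ 2 * ‖𝓕 v ξ‖ ^ 2) := by gcongr
    _ = _ := by simp only [mul_pow]

theorem hasDerivAt_line (a : 𝓢(R3, ℂ)) (x m : R3) :
    HasDerivAt (fun t : ℝ => a (x + t • m)) (∂_{m} a x) 0 := by
  rw [SchwartzMap.lineDerivOp_apply_eq_fderiv]
  exact (a.hasFDerivAt x).hasLineDerivAt m

theorem hasDerivAt_norm_sq_line (ε : ℝ) (x : R3) (j : Fin 3) :
    HasDerivAt (fun t : ℝ => ((ε ^ 2 + ‖x + t • stdVec j‖ ^ 2 : ℝ) : ℂ)) ((2 * x j : ℝ) : ℂ) 0 := by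
  have h : (fun t : ℝ => (ε ^ 2 + ‖x + t • stdVec j‖ ^ 2 : ℝ)) =
      fun t => ε ^ 2 + (‖x‖ ^ 2 + 2 * (t * x j) + t ^ 2) := by
    funext t
    rw [norm_add_sq_real, inner_smul_right, inner_stdVec, norm_smul]
    simp
  have h2 : HasDerivAt (fun t : ℝ => (ε ^ 2 + ‖x + t • stdVec j‖ ^ 2 : ℝ)) (2 * x j) 0 := by
    rw [h]
    have h3 := ((((hasDerivAt_id (0 : ℝ)).mul_const (x j)).const_mul 2).const_add (‖x‖ ^ 2)).add
      ((hasDerivAt_id (0 : ℝ)).pow 2)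
    simpa using h3.const_add (ε ^ 2)
  exact h2.ofReal_comp

theorem hasDerivAt_coord_line (x : R3) (j : Fin 3) :
    HasDerivAt (fun t : ℝ => ((2 * (x + t • stdVec j) j : ℝ) : ℂ)) 2 0 := by
  have h2 : HasDerivAt (fun t : ℝ => (2 * (x + t • stdVec j) j : ℝ)) 2 0 := by
    have h : (fun t : ℝ => (2 * (x + t • stdVec j) j : ℝ)) = fun t => 2 * (x j + t) := by
      funext t; simp [stdVec]
    rw [h]
    simpa using ((hasDerivAt_id (0 : ℝ)).const_add (x j)).const_mul 2
  simpa using h2.ofReal_comp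

/-- First derivative of the identity `(ε² + |ξ|²) a = b`. -/
theorem deriv_resolvent_symbol {ε : ℝ} {a b : 𝓢(R3, ℂ)}
    (h : ∀ ξ, ((ε ^ 2 + ‖ξ‖ ^ 2 : ℝ) : ℂ) * a ξ = b ξ) (j : Fin 3) (ξ : R3) :
    ((2 * ξ j : ℝ) : ℂ) * a ξ + ((ε ^ 2 + ‖ξ‖ ^ 2 : ℝ) : ℂ) * ∂_{stdVec j} a ξ =
      ∂_{stdVec j} b ξ := by
  have h1 := (hasDerivAt_norm_sq_line ε ξ j).mul (hasDerivAt_line a ξ (stdVec j))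
  have h2 := hasDerivAt_line b ξ (stdVec j)
  have h3 : (fun t : ℝ => b (ξ + t • stdVec j)) =
      (fun t : ℝ => ((ε ^ 2 + ‖ξ + t • stdVec j‖ ^ 2 : ℝ) : ℂ)) * fun t : ℝ => a (ξ + t • stdVec j) := by
    funext t; exact (h _).symm
  rw [h3] at h2
  simpa using h1.unique h2

/-- Second derivative of the identity `(ε² + |ξ|²) a = b`. -/
theorem deriv_deriv_resolvent_symbol {ε : ℝ} {a b : 𝓢(R3, ℂ)}
    (h : ∀ ξ, ((ε ^ 2 + ‖ξ‖ ^ 2 : ℝ) : ℂ) * a ξ = b ξ) (j : Fin 3) (ξ : R3) :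
    2 * a ξ + 2 * (((2 * ξ j : ℝ) : ℂ) * ∂_{stdVec j} a ξ) +
      ((ε ^ 2 + ‖ξ‖ ^ 2 : ℝ) : ℂ) * ∂_{stdVec j} (∂_{stdVec j} a) ξ =
      ∂_{stdVec j} (∂_{stdVec j} b) ξ := by
  have h1 := ((hasDerivAt_coord_line ξ j).mul (hasDerivAt_line a ξ (stdVec j))).add
    ((hasDerivAt_norm_sq_line ε ξ j).mul (hasDerivAt_line (∂_{stdVec j} a) ξ (stdVec j)))
  have h2 := hasDerivAt_line (∂_{stdVec j} b) ξ (stdVec j)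
  have h3 : (fun t : ℝ => ∂_{stdVec j} b (ξ + t • stdVec j)) =
      (fun t : ℝ => ((2 * (ξ + t • stdVec j) j : ℝ) : ℂ)) * (fun t : ℝ => a (ξ + t • stdVec j)) +
      (fun t : ℝ => ((ε ^ 2 + ‖ξ + t • stdVec j‖ ^ 2 : ℝ) : ℂ)) *
        fun t : ℝ => ∂_{stdVec j} a (ξ + t • stdVec j) := by
    funext t; exact (deriv_resolvent_symbol h j _).symm
  rw [h3] at h2
  have h4 := h1.unique h2
  rw [← h4]
  simp only [zero_smul, add_zero]
  ring

theorem norm_le_of_resolvent_symbol {ε B : ℝ} (hε : 0 < ε) {a b : 𝓢(R3, ℂ)}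
    (h : ∀ ξ, ((ε ^ 2 + ‖ξ‖ ^ 2 : ℝ) : ℂ) * a ξ = b ξ) (hB : ∀ ξ, ‖b ξ‖ ≤ B) (ξ : R3) :
    ‖a ξ‖ ≤ B * (ε ^ 2 + ‖ξ‖ ^ 2)⁻¹ := by
  have hm : 0 < ε ^ 2 + ‖ξ‖ ^ 2 := by positivity
  rw [← div_eq_mul_inv, le_div_iff₀ hm, mul_comm]
  have := hB ξ
  rwa [← h ξ, norm_mul, Complex.norm_real, Real.norm_of_nonneg hm.le] at this

/-- Each derivative falling on `(ε² + |ξ|²)⁻¹` costs a factor `ε⁻¹`, since `2ε|ξⱼ| ≤ ε² + |ξ|²`. -/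
theorem norm_deriv_deriv_le_of_resolvent_symbol {ε B : ℝ} (hε : 0 < ε) (hε1 : ε ≤ 1)
    {a b : 𝓢(R3, ℂ)} (h : ∀ ξ, ((ε ^ 2 + ‖ξ‖ ^ 2 : ℝ) : ℂ) * a ξ = b ξ) (j : Fin 3)
    (hB : ∀ ξ, ‖b ξ‖ ≤ B) (hB1 : ∀ ξ, ‖∂_{stdVec j} b ξ‖ ≤ B)
    (hB2 : ∀ ξ, ‖∂_{stdVec j} (∂_{stdVec j} b) ξ‖ ≤ B) (ξ : R3) :
    ‖∂_{stdVec j} (∂_{stdVec j} a) ξ‖ ≤ 7 * B * (ε ^ 2)⁻¹ * (ε ^ 2 + ‖ξ‖ ^ 2)⁻¹ := by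
  have hm : 0 < ε ^ 2 + ‖ξ‖ ^ 2 := by positivity
  set m := ε ^ 2 + ‖ξ‖ ^ 2 with hmdef
  have hB0 : 0 ≤ B := (norm_nonneg _).trans (hB 0)
  have hx : ε * (2 * |ξ j|) ≤ m := by
    have := abs_coord_le_norm ξ j
    nlinarith [sq_nonneg (ε - ‖ξ‖)]
  have h0 : m * ‖a ξ‖ ≤ B := by
    have := hB ξ
    rwa [← h ξ, norm_mul, Complex.norm_real, Real.norm_of_nonneg hm.le] at this
  have h1 : m * ‖∂_{stdVec j} a ξ‖ ≤ B + 2 * |ξ j| * ‖a ξ‖ := by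
    have e : ((m : ℝ) : ℂ) * ∂_{stdVec j} a ξ = ∂_{stdVec j} b ξ - ((2 * ξ j : ℝ) : ℂ) * a ξ := by
      rw [← deriv_resolvent_symbol h j ξ]; ring
    have := congrArg norm e
    rw [norm_mul, Complex.norm_real, Real.norm_of_nonneg hm.le] at this
    rw [this]
    refine (norm_sub_le _ _).trans (add_le_add (hB1 ξ) ?_)
    rw [norm_mul, Complex.norm_real, Real.norm_eq_abs, abs_mul]
    simp
  have h2 : m * ‖∂_{stdVec j} (∂_{stdVec j} a) ξ‖ ≤
      B + 2 * ‖a ξ‖ + 2 * (2 * |ξ j| * ‖∂_{stdVec j} a ξ‖) := by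
    have e : ((m : ℝ) : ℂ) * ∂_{stdVec j} (∂_{stdVec j} a) ξ = ∂_{stdVec j} (∂_{stdVec j} b) ξ -
        (2 * a ξ + 2 * (((2 * ξ j : ℝ) : ℂ) * ∂_{stdVec j} a ξ)) := by
      rw [← deriv_deriv_resolvent_symbol h j ξ]; ring
    have := congrArg norm e
    rw [norm_mul, Complex.norm_real, Real.norm_of_nonneg hm.le] at this
    rw [this, add_assoc]
    refine (norm_sub_le _ _).trans (add_le_add (hB2 ξ) ((norm_add_le _ _).trans ?_))
    simp
  set A0 := ‖a ξ‖
  set A1 := ‖∂_{stdVec j} a ξ‖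
  set A2 := ‖∂_{stdVec j} (∂_{stdVec j} a) ξ‖
  have hA0 : 0 ≤ A0 := norm_nonneg _
  have hA1 : 0 ≤ A1 := norm_nonneg _
  have hεm : ε ^ 2 ≤ m := by rw [hmdef]; nlinarith [sq_nonneg ‖ξ‖]
  have k0 : ε ^ 2 * A0 ≤ B := (mul_le_mul_of_nonneg_right hεm hA0).trans h0
  have k1 : ε * (m * A1) ≤ 2 * B := by
    have : ε * (2 * |ξ j| * A0) ≤ B := by
      calc ε * (2 * |ξ j| * A0) = (ε * (2 * |ξ j|)) * A0 := by ring
        _ ≤ m * A0 := by gcongr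
        _ ≤ B := h0
    nlinarith
  have k2 : ε ^ 2 * (2 * |ξ j| * A1) ≤ 2 * B := by
    calc ε ^ 2 * (2 * |ξ j| * A1) = (ε * (2 * |ξ j|)) * (ε * A1) := by ring
      _ ≤ m * (ε * A1) := by gcongr
      _ = ε * (m * A1) := by ring
      _ ≤ 2 * B := k1
  -- The three terms of `h2` contribute `B`, `2 * B` and `4 * B`, whence the constant 7.
  have k3 : ε ^ 2 * (m * A2) ≤ 7 * B := by
    have : ε ^ 2 * B ≤ B := mul_le_of_le_one_left hB0 (by nlinarith)
    nlinarith [mul_le_mul_of_nonneg_left h2 (sq_nonneg ε)]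
  rw [← div_eq_mul_inv, ← div_eq_mul_inv, le_div_iff₀ hm, le_div_iff₀ (by positivity)]
  linarith

end

/-! ### Smallness of `ε²⟨f, v⟩` -/

section Weighted

open FourierTransform Real Filter Topology

theorem bracket_sq (x : R3) : bracket x ^ 2 = 1 + ‖x‖ ^ 2 := by
  rw [bracket, Real.sq_sqrt (by positivity)]

theorem continuous_bracket : Continuous bracket := by
  unfold bracket; fun_prop

theorem integrable_inv_one_add_norm_sq_sq :
    Integrable fun ξ : R3 => ((1 + ‖ξ‖ ^ 2)⁻¹) ^ 2 := by
  have h : Integrable fun ξ : R3 => (1 + ‖ξ‖ ^ 2) ^ (-(4 : ℝ) / 2) :=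
    integrable_rpow_neg_one_add_norm_sq (by simp; norm_num)
  refine h.congr (Eventually.of_forall fun ξ => ?_)
  simp only
  rw [show (-(4 : ℝ) / 2) = ((-2 : ℤ) : ℝ) by norm_num, Real.rpow_intCast, inv_pow]
  rfl

theorem inv_sq_add_norm_sq_eq {ε : ℝ} (hε : 0 < ε) (ξ : R3) :
    ((ε ^ 2 + ‖ξ‖ ^ 2)⁻¹) ^ 2 = (ε ^ 4)⁻¹ * ((1 + ‖ε⁻¹ • ξ‖ ^ 2)⁻¹) ^ 2 := by
  rw [norm_smul, norm_inv, Real.norm_of_nonneg hε.le]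
  field_simp

theorem integrable_inv_sq_add_norm_sq_sq {ε : ℝ} (hε : 0 < ε) :
    Integrable fun ξ : R3 => ((ε ^ 2 + ‖ξ‖ ^ 2)⁻¹) ^ 2 := by
  simp_rw [inv_sq_add_norm_sq_eq hε]
  exact (integrable_inv_one_add_norm_sq_sq.comp_smul (inv_ne_zero hε.ne')).const_mul _

/-- Scaling `ξ = ε y` in dimension three: `ε⁻⁴ · ε³ = ε⁻¹`. -/
theorem integral_inv_sq_add_norm_sq_sq {ε : ℝ} (hε : 0 < ε) :
    ∫ ξ : R3, ((ε ^ 2 + ‖ξ‖ ^ 2)⁻¹) ^ 2 = ε⁻¹ * ∫ ξ : R3, ((1 + ‖ξ‖ ^ 2)⁻¹) ^ 2 := by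
  simp_rw [inv_sq_add_norm_sq_eq hε]
  rw [integral_const_mul,
    Measure.integral_comp_smul volume (fun ξ : R3 => ((1 + ‖ξ‖ ^ 2)⁻¹) ^ 2) ε⁻¹]
  simp only [finrank_euclideanSpace, Fintype.card_fin, smul_eq_mul]
  rw [abs_of_pos (by positivity), ← mul_assoc]
  congr 1
  field_simp

theorem SchwartzMap.exists_norm_apply_le (b : 𝓢(R3, ℂ)) : ∃ B, ∀ ξ, ‖b ξ‖ ≤ B :=
  ⟨_, fun ξ => SchwartzMap.norm_le_seminorm ℝ b ξ⟩

theorem exists_uniform_deriv_bound (b : 𝓢(R3, ℂ)) : ∃ B, 0 ≤ B ∧ (∀ ξ, ‖b ξ‖ ≤ B) ∧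
    (∀ j ξ, ‖∂_{stdVec j} b ξ‖ ≤ B) ∧ ∀ j ξ, ‖∂_{stdVec j} (∂_{stdVec j} b) ξ‖ ≤ B := by
  obtain ⟨B0, h0⟩ := b.exists_norm_apply_le
  choose B1 h1 using fun j : Fin 3 => (∂_{stdVec j} b).exists_norm_apply_le
  choose B2 h2 using fun j : Fin 3 => (∂_{stdVec j} (∂_{stdVec j} b)).exists_norm_apply_le
  have p0 : 0 ≤ B0 := (norm_nonneg _).trans (h0 0)
  have p1 : ∀ j, 0 ≤ B1 j := fun j => (norm_nonneg _).trans (h1 j 0)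
  have p2 : ∀ j, 0 ≤ B2 j := fun j => (norm_nonneg _).trans (h2 j 0)
  have q1 : ∀ j, B1 j ≤ ∑ j, B1 j := fun j =>
    Finset.single_le_sum (fun i _ => p1 i) (Finset.mem_univ j)
  have q2 : ∀ j, B2 j ≤ ∑ j, B2 j := fun j =>
    Finset.single_le_sum (fun i _ => p2 i) (Finset.mem_univ j)
  have r1 : 0 ≤ ∑ j, B1 j := Finset.sum_nonneg fun i _ => p1 i
  have r2 : 0 ≤ ∑ j, B2 j := Finset.sum_nonneg fun i _ => p2 i
  refine ⟨B0 + ∑ j, B1 j + ∑ j, B2 j, by positivity, fun ξ => ?_, fun j ξ => ?_, fun j ξ => ?_⟩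
  · linarith [h0 ξ]
  · linarith [h1 j ξ, q1 j]
  · linarith [h2 j ξ, q2 j]

/-- Plancherel for `-(2π)²|x|² v`, whose Fourier transform is `Δ(𝓕 v)`; the factor `(2π)⁴ ≥ 1` is
discarded. -/
theorem integral_norm_pow_four_mul_le (v : 𝓢(R3, ℂ)) :
    (Integrable fun x => ‖x‖ ^ 4 * ‖v x‖ ^ 2) ∧ ∫ x, ‖x‖ ^ 4 * ‖v x‖ ^ 2 ≤
      ∫ ξ, ‖∑ j : Fin 3, ∂_{stdVec j} (∂_{stdVec j} (𝓕 v)) ξ‖ ^ 2 := by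
  set c : ℂ := -(2 * π * Complex.I)
  set S : Fin 3 → 𝓢(R3, ℂ) →L[ℝ] 𝓢(R3, ℂ) :=
    fun j => SchwartzMap.smulLeftCLM ℂ (fun x : R3 => x j)
  set g : 𝓢(R3, ℂ) := ∑ j, c • S j (c • S j v)
  have hg : ∀ x, g x = -((2 * π) ^ 2 * ‖x‖ ^ 2 : ℝ) * v x := by
    intro x
    have hS : ∀ j (w : 𝓢(R3, ℂ)), S j w x = (x j : ℂ) * w x := by
      intro j w
      have : (fun x : R3 => x j).HasTemperateGrowth := by
        have e : (fun x : R3 => x j) = fun x : R3 => inner ℝ x (stdVec j) := by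
          funext x; rw [inner_stdVec]
        rw [e]; fun_prop
      simp only [S]
      rw [SchwartzMap.smulLeftCLM_apply_apply this, Complex.real_smul]
    simp only [g, sum_apply, smul_apply, hS, smul_eq_mul]
    rw [← sum_coord_sq, Fin.sum_univ_three, Fin.sum_univ_three]
    simp only [c]
    push_cast
    ring_nf
    simp only [Complex.I_sq]
    ring
  have hFg : ∀ ξ, 𝓕 g ξ = ∑ j : Fin 3, ∂_{stdVec j} (∂_{stdVec j} (𝓕 v)) ξ := by
    intro ξ
    simp only [g, FourierTransform.fourier_sum, sum_apply]
    refine Finset.sum_congr rfl fun j _ => ?_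
    rw [lineDeriv_fourier_eq, lineDeriv_fourier_eq]
  have hng : ∀ x, ‖g x‖ ^ 2 = (2 * π) ^ 4 * (‖x‖ ^ 4 * ‖v x‖ ^ 2) := by
    intro x
    rw [hg, norm_mul, norm_neg, Complex.norm_real, Real.norm_of_nonneg (by positivity)]
    ring
  have h1 : (1 : ℝ) ≤ (2 * π) ^ 4 := one_le_pow₀ (by linarith [Real.pi_gt_three])
  have hint : Integrable fun x => ‖x‖ ^ 4 * ‖v x‖ ^ 2 := by
    refine ((integrable_norm_sq g).const_mul (((2 * π) ^ 4)⁻¹)).congr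
      (Eventually.of_forall fun x => ?_)
    simp only [hng]
    field_simp
  refine ⟨hint, ?_⟩
  simp_rw [← hFg]
  rw [SchwartzMap.integral_norm_sq_fourier]
  refine integral_mono hint (integrable_norm_sq g) fun x => ?_
  simp only [hng]
  exact le_mul_of_one_le_left (by positivity) h1

/-- Uniform weighted bound for the solutions of `(ε² - (2π)⁻² Δ) v = φ`. -/
theorem exists_resolvent_weighted_bound (φ : 𝓢(R3, ℂ)) : ∃ M, 0 ≤ M ∧ ∀ ε, 0 < ε → ε ≤ 1 →
    ∀ v : 𝓢(R3, ℂ), (∀ ξ, ((ε ^ 2 + ‖ξ‖ ^ 2 : ℝ) : ℂ) * 𝓕 v ξ = 𝓕 φ ξ) →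
      (Integrable fun x => (ε + ε ^ 5 * bracket x ^ 4) * ‖v x‖ ^ 2) ∧
      ∫ x, (ε + ε ^ 5 * bracket x ^ 4) * ‖v x‖ ^ 2 ≤ M := by
  obtain ⟨B, hB0, hb0, hb1, hb2⟩ := exists_uniform_deriv_bound (𝓕 φ)
  set K := ∫ ξ : R3, ((1 + ‖ξ‖ ^ 2)⁻¹) ^ 2
  have hK : 0 ≤ K := integral_nonneg fun ξ => by positivity
  -- The weight balances `∫ |v|² = O(ε⁻¹)` against `∫ |x|⁴|v|² = O(ε⁻⁵)`. Constants: `ε + 2ε⁵ ≤ 3ε`,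
  -- `⟨x⟩⁴ ≤ 2 + 2|x|⁴`, and `21 = 3 · 7` from summing the second-derivative bound over three
  -- directions.
  refine ⟨3 * (B ^ 2 * K) + 2 * ((21 * B) ^ 2 * K), by positivity, fun ε hε hε1 v hv => ?_⟩
  obtain ⟨hi4, hle4⟩ := integral_norm_pow_four_mul_le v
  have hI0 : ∫ x, ‖v x‖ ^ 2 ≤ B ^ 2 * (ε⁻¹ * K) := by
    rw [← SchwartzMap.integral_norm_sq_fourier, ← integral_inv_sq_add_norm_sq_sq hε,
      ← integral_const_mul]
    refine integral_mono (integrable_norm_sq _)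
      ((integrable_inv_sq_add_norm_sq_sq hε).const_mul _) fun ξ => ?_
    simp only
    rw [← mul_pow]
    gcongr
    exact norm_le_of_resolvent_symbol hε hv hb0 ξ
  have hI4 : ∫ x, ‖x‖ ^ 4 * ‖v x‖ ^ 2 ≤ (21 * B * (ε ^ 2)⁻¹) ^ 2 * (ε⁻¹ * K) := by
    refine hle4.trans ?_
    rw [← integral_inv_sq_add_norm_sq_sq hε, ← integral_const_mul]
    have hint := integrable_norm_sq (∑ j : Fin 3, ∂_{stdVec j} (∂_{stdVec j} (𝓕 v)))
    simp only [sum_apply] at hint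
    refine integral_mono hint
      ((integrable_inv_sq_add_norm_sq_sq hε).const_mul _) fun ξ => ?_
    simp only
    rw [← mul_pow]
    gcongr
    refine (norm_sum_le_of_le _ fun j _ => norm_deriv_deriv_le_of_resolvent_symbol hε hε1 hv j hb0
      (hb1 j) (hb2 j) ξ).trans (le_of_eq ?_)
    simp only [Finset.sum_const, Finset.card_univ, Fintype.card_fin, nsmul_eq_mul]
    push_cast
    ring
  have hdom : Integrable fun x => (ε + 2 * ε ^ 5) * ‖v x‖ ^ 2 + 2 * ε ^ 5 * (‖x‖ ^ 4 * ‖v x‖ ^ 2) :=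
    ((integrable_norm_sq v).const_mul _).add (hi4.const_mul _)
  have hpt : ∀ x, (ε + ε ^ 5 * bracket x ^ 4) * ‖v x‖ ^ 2 ≤
      (ε + 2 * ε ^ 5) * ‖v x‖ ^ 2 + 2 * ε ^ 5 * (‖x‖ ^ 4 * ‖v x‖ ^ 2) := by
    intro x
    have : bracket x ^ 4 ≤ 2 + 2 * ‖x‖ ^ 4 := by
      rw [show bracket x ^ 4 = (bracket x ^ 2) ^ 2 by ring, bracket_sq]
      nlinarith [sq_nonneg (1 - ‖x‖ ^ 2)]
    calc _ ≤ (ε + ε ^ 5 * (2 + 2 * ‖x‖ ^ 4)) * ‖v x‖ ^ 2 := by gcongr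
      _ = _ := by ring
  have hint : Integrable fun x => (ε + ε ^ 5 * bracket x ^ 4) * ‖v x‖ ^ 2 := by
    refine hdom.mono' ?_ (Eventually.of_forall fun x => ?_)
    · have := continuous_bracket
      have h2 : Continuous v := v.continuous
      exact Continuous.aestronglyMeasurable (by fun_prop)
    · rw [Real.norm_of_nonneg (by have := bracket_pos x; positivity)]
      exact hpt x
  refine ⟨hint, (integral_mono hint hdom hpt).trans ?_⟩
  rw [integral_add ((integrable_norm_sq v).const_mul _) (hi4.const_mul _), integral_const_mul,
    integral_const_mul]
  have hε5 : ε ^ 5 ≤ ε := by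
    calc ε ^ 5 ≤ ε ^ 1 := pow_le_pow_of_le_one hε.le hε1 (by norm_num)
      _ = ε := pow_one ε
  have h1 : (ε + 2 * ε ^ 5) * ∫ x, ‖v x‖ ^ 2 ≤ 3 * (B ^ 2 * K) := by
    calc (ε + 2 * ε ^ 5) * ∫ x, ‖v x‖ ^ 2 ≤ (3 * ε) * (B ^ 2 * (ε⁻¹ * K)) := by
          refine mul_le_mul (by linarith) hI0 (integral_nonneg fun x => by positivity) (by positivity)
      _ = 3 * (B ^ 2 * K) := by field_simp
  have h2 : 2 * ε ^ 5 * ∫ x, ‖x‖ ^ 4 * ‖v x‖ ^ 2 ≤ 2 * ((21 * B) ^ 2 * K) := by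
    calc 2 * ε ^ 5 * ∫ x, ‖x‖ ^ 4 * ‖v x‖ ^ 2 ≤
        2 * ε ^ 5 * ((21 * B * (ε ^ 2)⁻¹) ^ 2 * (ε⁻¹ * K)) := by gcongr
      _ = 2 * ((21 * B) ^ 2 * K) := by field_simp
  linarith

/-- Weighted Cauchy–Schwarz inequality for the pairing of a scalar function and a spinor field. -/
theorem norm_integral_smul_le {φ : R3 → ℂ} {g : R3 → C4} {w : R3 → ℝ} (hw : ∀ x, 0 < w x)
    (hwm : Continuous w) (hφ : Continuous φ) (hg : AEStronglyMeasurable g)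
    (hiφ : Integrable fun x => w x * ‖φ x‖ ^ 2) (hig : Integrable fun x => (w x)⁻¹ * ‖g x‖ ^ 2) :
    ‖∫ x, φ x • g x‖ ≤ √(∫ x, w x * ‖φ x‖ ^ 2) * √(∫ x, (w x)⁻¹ * ‖g x‖ ^ 2) := by
  have e1 : ∀ x, (√(w x) * ‖φ x‖) ^ 2 = w x * ‖φ x‖ ^ 2 := fun x => by
    rw [mul_pow, Real.sq_sqrt (hw x).le]
  have e2 : ∀ x, ((√(w x))⁻¹ * ‖g x‖) ^ 2 = (w x)⁻¹ * ‖g x‖ ^ 2 := fun x => by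
    rw [mul_pow, inv_pow, Real.sq_sqrt (hw x).le]
  have hws : Continuous fun x => √(w x) := by fun_prop
  have hwi : Continuous fun x => (√(w x))⁻¹ := hws.inv₀ fun x => (Real.sqrt_pos.2 (hw x)).ne'
  have m1 : MemLp (fun x => √(w x) * ‖φ x‖) 2 volume := by
    have hm : AEStronglyMeasurable (fun x => √(w x) * ‖φ x‖) volume :=
      (hws.mul hφ.norm).aestronglyMeasurable
    rw [memLp_two_iff_integrable_sq hm]
    simpa only [e1] using hiφ
  have m2 : MemLp (fun x => (√(w x))⁻¹ * ‖g x‖) 2 volume := by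
    have hm : AEStronglyMeasurable (fun x => (√(w x))⁻¹ * ‖g x‖) volume :=
      hwi.aestronglyMeasurable.mul hg.norm
    rw [memLp_two_iff_integrable_sq hm]
    simpa only [e2] using hig
  have hol := integral_mul_le_Lp_mul_Lq_of_nonneg (μ := (volume : Measure R3))
    (Real.HolderConjugate.two_two)
    (Eventually.of_forall fun x => by positivity : 0 ≤ᵐ[volume] fun x => √(w x) * ‖φ x‖)
    (Eventually.of_forall fun x => by positivity : 0 ≤ᵐ[volume] fun x => (√(w x))⁻¹ * ‖g x‖)
    (by simpa using m1) (by simpa using m2)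
  simp only [Real.rpow_two, e1, e2, ← Real.sqrt_eq_rpow] at hol
  refine (norm_integral_le_integral_norm _).trans (le_trans (le_of_eq ?_) hol)
  refine integral_congr_ae (Eventually.of_forall fun x => ?_)
  have := (Real.sqrt_pos.2 (hw x)).ne'
  simp only [norm_smul]
  field_simp

theorem MemWeightedL2.aestronglyMeasurable {σ : ℝ} {f : R3 → C4} (hf : MemWeightedL2 σ f) :
    AEStronglyMeasurable f := by
  have hc : Continuous fun x => bracket x ^ (-σ) :=
    continuous_bracket.rpow_const fun x => Or.inl (bracket_pos x).ne'
  refine (hc.aestronglyMeasurable.smul hf.1).congr (Eventually.of_forall fun x => ?_)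
  change bracket x ^ (-σ) • bracket x ^ σ • f x = f x
  rw [smul_smul, ← Real.rpow_add (bracket_pos x), neg_add_cancel, Real.rpow_zero, one_smul]

theorem MemWeightedL2.integrable {σ τ : ℝ} {f : R3 → C4} (hf : MemWeightedL2 σ f)
    (h : τ ≤ 2 * σ) : Integrable fun x => bracket x ^ τ * ‖f x‖ ^ 2 := by
  have h1 := hf.integrable_norm_pow (by norm_num)
  have hc : Continuous fun x => bracket x ^ τ :=
    continuous_bracket.rpow_const fun x => Or.inl (bracket_pos x).ne'
  refine h1.mono' (hc.aestronglyMeasurable.mul (hf.aestronglyMeasurable.norm.pow 2))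
    (Eventually.of_forall fun x => ?_)
  have hb := bracket_pos x
  rw [Real.norm_of_nonneg (by positivity), norm_smul, Real.norm_of_nonneg (by positivity), mul_pow]
  gcongr
  rw [← Real.rpow_mul_natCast hb.le]
  exact Real.rpow_le_rpow_of_exponent_le (one_le_bracket x) (by push_cast; linarith)

/-- Cauchy–Schwarz with weight `w = ε + ε⁵⟨x⟩⁴`: the factor with `v` is bounded uniformly in `ε`,
and `ε⁴ ∫ w⁻¹|f|²` tends to 0 by dominated convergence with majorant `⟨x⟩⁻³|f|²`, integrable exactly
because `s ≤ 3/2`. At the endpoint the direct estimate gives only boundedness, so dominated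
convergence is essential. -/
theorem resolvent_pairing_small {s : ℝ} (hs : s ≤ 3 / 2) {f : R3 → C4}
    (hf : MemWeightedL2 (-s) f) (φ : 𝓢(R3, ℂ)) {δ : ℝ} (hδ : 0 < δ) :
    ∃ ε, 0 < ε ∧ ∀ v : 𝓢(R3, ℂ), (∀ ξ, ((ε ^ 2 + ‖ξ‖ ^ 2 : ℝ) : ℂ) * 𝓕 v ξ = 𝓕 φ ξ) →
      ε ^ 2 * ‖∫ x, v x • f x‖ ≤ δ := by
  obtain ⟨M, hM, hbound⟩ := exists_resolvent_weighted_bound φ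
  have hf3 : Integrable fun x => bracket x ^ (-3 : ℝ) * ‖f x‖ ^ 2 := hf.integrable (by linarith)
  have hcont : ∀ ε : ℝ, Continuous fun x => ε + ε ^ 5 * bracket x ^ 4 := fun ε => by
    have := continuous_bracket
    fun_prop
  have hpos : ∀ ε : ℝ, 0 < ε → ∀ x, 0 < ε + ε ^ 5 * bracket x ^ 4 := fun ε hε x => by
    have := bracket_pos x
    positivity
  have hmeas : ∀ ε : ℝ, 0 < ε → AEStronglyMeasurable
      (fun x => ε ^ 4 * ((ε + ε ^ 5 * bracket x ^ 4)⁻¹ * ‖f x‖ ^ 2)) := fun ε hε =>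
    (((hcont ε).inv₀ fun x => (hpos ε hε x).ne').aestronglyMeasurable.mul
      (hf.aestronglyMeasurable.norm.pow 2)).const_mul _
  have hdom : ∀ ε : ℝ, 0 < ε → ∀ x, ‖ε ^ 4 * ((ε + ε ^ 5 * bracket x ^ 4)⁻¹ * ‖f x‖ ^ 2)‖ ≤
      bracket x ^ (-3 : ℝ) * ‖f x‖ ^ 2 := fun ε hε x => by
    have hb := bracket_pos x
    have hp := hpos ε hε x
    rw [Real.norm_of_nonneg (by positivity), ← mul_assoc]
    gcongr
    rw [Real.rpow_neg hb.le, ← div_eq_mul_inv, div_le_iff₀ hp, ← div_eq_inv_mul,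
      le_div_iff₀ (by positivity)]
    norm_cast
    -- The domination `ε⁴/w ≤ ⟨x⟩⁻³` reduces to `t³ ≤ 1 + t⁴` for `t = ε⟨x⟩`.
    have : (ε * bracket x) ^ 3 ≤ 1 + (ε * bracket x) ^ 4 := by
      have ht : 0 ≤ ε * bracket x := by positivity
      nlinarith [sq_nonneg (ε * bracket x), sq_nonneg ((ε * bracket x) ^ 2 - ε * bracket x / 2),
        sq_nonneg (ε * bracket x - 1), mul_nonneg ht ht, sq_nonneg ((ε * bracket x) ^ 2 - 1)]
    calc ε ^ 4 * bracket x ^ 3 = ε * (ε * bracket x) ^ 3 := by ring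
      _ ≤ ε * (1 + (ε * bracket x) ^ 4) := by gcongr
      _ = _ := by ring
  have hlim : Tendsto (fun ε : ℝ => ∫ x, ε ^ 4 * ((ε + ε ^ 5 * bracket x ^ 4)⁻¹ * ‖f x‖ ^ 2))
      (𝓝[>] 0) (𝓝 (∫ _ : R3, (0 : ℝ))) := by
    refine tendsto_integral_filter_of_dominated_convergence _ ?_ ?_ hf3 ?_
    · filter_upwards [self_mem_nhdsWithin] with ε hε using hmeas ε hε
    · filter_upwards [self_mem_nhdsWithin] with ε hε using Eventually.of_forall (hdom ε hε)
    · refine Eventually.of_forall fun x => ?_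
      have hb := bracket_pos x
      -- Pointwise convergence follows from `w ≥ ε`, that is, `ε⁴/w ≤ ε³`.
      have h0 : Tendsto (fun ε : ℝ => ε ^ 3 * ‖f x‖ ^ 2) (𝓝[>] 0) (𝓝 0) := by
        have : Continuous fun ε : ℝ => ε ^ 3 * ‖f x‖ ^ 2 := by fun_prop
        simpa using (this.tendsto 0).mono_left nhdsWithin_le_nhds
      refine squeeze_zero' ?_ ?_ h0
      · filter_upwards [self_mem_nhdsWithin] with ε hε
        have := hpos ε hε x
        have hε : 0 < ε := hε
        positivity
      · filter_upwards [self_mem_nhdsWithin] with ε hε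
        have hp := hpos ε hε x
        have hε : 0 < ε := hε
        rw [← mul_assoc]
        gcongr
        rw [← div_eq_mul_inv, div_le_iff₀ hp]
        have : 0 ≤ ε ^ 3 * (ε ^ 5 * bracket x ^ 4) := by positivity
        nlinarith
  rw [integral_zero] at hlim
  have hlim2 : Tendsto (fun ε : ℝ => √M *
      √(∫ x, ε ^ 4 * ((ε + ε ^ 5 * bracket x ^ 4)⁻¹ * ‖f x‖ ^ 2))) (𝓝[>] 0) (𝓝 0) := by
    simpa using (hlim.sqrt).const_mul (√M)
  obtain ⟨ε, hεδ, hε0, hε1⟩ := ((hlim2.eventually_lt_const hδ).and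
    (Ioc_mem_nhdsGT (zero_lt_one' ℝ))).exists
  refine ⟨ε, hε0, fun v hv => ?_⟩
  obtain ⟨hvi, hvM⟩ := hbound ε hε0 hε1 v hv
  have hig : Integrable fun x => (ε + ε ^ 5 * bracket x ^ 4)⁻¹ * ‖f x‖ ^ 2 := by
    have := (hf3.mono' (hmeas ε hε0) (Eventually.of_forall (hdom ε hε0))).const_mul ((ε ^ 4)⁻¹)
    refine this.congr (Eventually.of_forall fun x => ?_)
    simp only
    field_simp
  have key := norm_integral_smul_le (hpos ε hε0) (hcont ε) v.continuous hf.aestronglyMeasurable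
    hvi hig
  refine le_trans ?_ hεδ.le
  rw [integral_const_mul, Real.sqrt_mul (by positivity),
    show √(ε ^ 4) = ε ^ 2 by rw [show ε ^ 4 = (ε ^ 2) ^ 2 by ring, Real.sqrt_sq (by positivity)]]
  calc _ ≤ ε ^ 2 * (√M * √(∫ x, (ε + ε ^ 5 * bracket x ^ 4)⁻¹ * ‖f x‖ ^ 2)) := by
        gcongr
        exact key.trans (by gcongr)
    _ = _ := by ring

end Weighted

/-! ### Hardy's inequality with weight `(1 + |x|²)⁻¹` -/

noncomputable section Hardy

open Real Filter Topology

/-- The components of the vector field `x / (1 + |x|²)`. -/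
def hardyField (j : Fin 3) (x : R3) : ℝ := x j * (1 + ‖x‖ ^ 2)⁻¹

theorem hasTemperateGrowth_hardyField (j : Fin 3) : (hardyField j).HasTemperateGrowth := by
  have e : hardyField j = fun x : R3 => inner ℝ x (stdVec j) * ((1 : ℝ) ^ 2 + ‖x‖ ^ 2)⁻¹ := by
    funext x; rw [inner_stdVec, one_pow, hardyField]
  rw [e]
  refine Function.HasTemperateGrowth.mul (by fun_prop)
    (hasTemperateGrowth_inv_sq_add_norm_sq one_pos)

theorem sum_hardyField_sq_le (x : R3) : ∑ j, hardyField j x ^ 2 ≤ (1 + ‖x‖ ^ 2)⁻¹ := by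
  have hb : 0 < 1 + ‖x‖ ^ 2 := by positivity
  simp only [hardyField, mul_pow]
  rw [← Finset.sum_mul, sum_coord_sq]
  field_simp
  linarith

/-- The partial derivative `∂ⱼ` of the `j`-th component of `hardyField`. -/
def hardyFieldDeriv (j : Fin 3) (x : R3) : ℝ :=
  (1 + ‖x‖ ^ 2)⁻¹ - 2 * x j ^ 2 * ((1 + ‖x‖ ^ 2)⁻¹) ^ 2

theorem hasDerivAt_hardyField_line (j : Fin 3) (x : R3) :
    HasDerivAt (fun t : ℝ => hardyField j (x + t • stdVec j)) (hardyFieldDeriv j x) 0 := by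
  have h : (fun t : ℝ => hardyField j (x + t • stdVec j)) =
      fun t => (x j + t) * (1 + (‖x‖ ^ 2 + 2 * (t * x j) + t ^ 2))⁻¹ := by
    funext t
    rw [hardyField, norm_add_sq_real, inner_smul_right, inner_stdVec, norm_smul]
    simp [stdVec]
  rw [h]
  have h3 := ((((hasDerivAt_id (0 : ℝ)).mul_const (x j)).const_mul 2).const_add (‖x‖ ^ 2)).add
      ((hasDerivAt_id (0 : ℝ)).pow 2)
  have h4 := (h3.const_add 1).inv (by simp; positivity)
  have h5 := ((hasDerivAt_id (0 : ℝ)).const_add (x j)).mul h4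
  refine h5.congr_deriv ?_
  have : 1 + ‖x‖ ^ 2 ≠ 0 := by positivity
  simp [hardyFieldDeriv]
  field_simp
  ring

/-- In dimension three the divergence of the field equals `(3 + |x|²)/(1 + |x|²)²`. -/
theorem inv_le_sum_hardyFieldDeriv (x : R3) :
    (1 + ‖x‖ ^ 2)⁻¹ ≤ ∑ j, hardyFieldDeriv j x := by
  have hb : 0 < 1 + ‖x‖ ^ 2 := by positivity
  simp only [hardyFieldDeriv, Finset.sum_sub_distrib]
  rw [← Finset.sum_mul, ← Finset.mul_sum, sum_coord_sq]
  simp only [Finset.sum_const, Finset.card_univ, Fintype.card_fin, nsmul_eq_mul]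
  field_simp
  push_cast
  nlinarith [sq_nonneg ‖x‖]

theorem SchwartzMap.integrable_real_inner (u w : 𝓢(R3, ℂ)) :
    Integrable fun x => (inner ℝ (u x) (w x) : ℝ) := by
  refine ((integrable_norm_sq u).add (integrable_norm_sq w)).mono'
    (u.continuous.inner w.continuous).aestronglyMeasurable (Eventually.of_forall fun x => ?_)
  refine (norm_inner_le_norm _ _).trans ?_
  simp only [Pi.add_apply]
  nlinarith [sq_nonneg (‖u x‖ - ‖w x‖), sq_nonneg (‖u x‖ + ‖w x‖)]

/-- Integration by parts against `∂ⱼ|w|² = 2 Re⟨w, ∂ⱼw⟩`; the real inner product on `ℂ` supplies the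
real part. -/
theorem integral_hardyFieldDeriv_mul (w : 𝓢(R3, ℂ)) (j : Fin 3) :
    (Integrable fun x => hardyFieldDeriv j x * ‖w x‖ ^ 2) ∧
    (Integrable fun x => 2 * (hardyField j x * inner ℝ (w x) (∂_{stdVec j} w x))) ∧
    ∫ x, hardyFieldDeriv j x * ‖w x‖ ^ 2 =
      -∫ x, 2 * (hardyField j x * inner ℝ (w x) (∂_{stdVec j} w x)) := by
  set Fw : 𝓢(R3, ℂ) := SchwartzMap.smulLeftCLM ℂ (hardyField j) w
  have hFw : ∀ x, Fw x = hardyField j x • w x := fun x =>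
    SchwartzMap.smulLeftCLM_apply_apply (hasTemperateGrowth_hardyField j) w x
  have hdFw : ∀ x, ∂_{stdVec j} Fw x =
      hardyField j x • ∂_{stdVec j} w x + hardyFieldDeriv j x • w x := by
    intro x
    have h1 := hasDerivAt_line Fw x (stdVec j)
    have h2 := (hasDerivAt_hardyField_line j x).smul (hasDerivAt_line w x (stdVec j))
    have h3 : (fun t : ℝ => Fw (x + t • stdVec j)) = (fun t : ℝ => hardyField j (x + t • stdVec j)) •
        fun t : ℝ => w (x + t • stdVec j) := by
      funext t; exact hFw _
    rw [h3] at h1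
    simpa using h1.unique h2
  have hip := SchwartzMap.integral_bilinear_lineDerivOp_right_eq_neg_left (μ := volume) Fw w
    (innerSL ℝ) (stdVec j)
  change ∫ x, (inner ℝ (Fw x) (∂_{stdVec j} w x) : ℝ) =
    -∫ x, (inner ℝ (∂_{stdVec j} Fw x) (w x) : ℝ) at hip
  simp only [hFw, hdFw, inner_add_left, inner_smul_left, conj_trivial,
    real_inner_self_eq_norm_sq] at hip
  have i1 : Integrable fun x => hardyField j x * inner ℝ (w x) (∂_{stdVec j} w x) := by
    have := Fw.integrable_real_inner (∂_{stdVec j} w)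
    simpa only [hFw, inner_smul_left, conj_trivial] using this
  have i2 : Integrable fun x => hardyFieldDeriv j x * ‖w x‖ ^ 2 := by
    have := (∂_{stdVec j} Fw).integrable_real_inner w
    simp only [hdFw, inner_add_left, inner_smul_left, conj_trivial,
      real_inner_self_eq_norm_sq] at this
    refine (this.sub i1).congr (Eventually.of_forall fun x => ?_)
    simp only [Pi.sub_apply]
    rw [real_inner_comm (w x) (∂_{stdVec j} w x)]
    ring
  have hc : ∀ x, (inner ℝ (∂_{stdVec j} w x) (w x) : ℝ) = inner ℝ (w x) (∂_{stdVec j} w x) :=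
    fun x => real_inner_comm _ _
  simp only [hc] at hip
  rw [integral_add i1 i2] at hip
  refine ⟨i2, i1.const_mul 2, ?_⟩
  rw [integral_const_mul]
  linarith

/-- Hardy's inequality with the inhomogeneous weight `⟨x⟩⁻²`. -/
theorem hardy_inequality (w : 𝓢(R3, ℂ)) :
    ∫ x : R3, (1 + ‖x‖ ^ 2)⁻¹ * ‖w x‖ ^ 2 ≤ 4 * ∑ j : Fin 3, ∫ x, ‖∂_{stdVec j} w x‖ ^ 2 := by
  have hint : Integrable fun x : R3 => (1 + ‖x‖ ^ 2)⁻¹ * ‖w x‖ ^ 2 := by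
    have hc : Continuous fun x : R3 => (1 + ‖x‖ ^ 2)⁻¹ * ‖w x‖ ^ 2 :=
      ((by fun_prop : Continuous fun x : R3 => 1 + ‖x‖ ^ 2).inv₀ fun x => by positivity).mul
        (w.continuous.norm.pow 2)
    refine (integrable_norm_sq w).mono' hc.aestronglyMeasurable (Eventually.of_forall fun x => ?_)
    rw [Real.norm_of_nonneg (by positivity)]
    exact mul_le_of_le_one_left (by positivity)
      (inv_le_one_of_one_le₀ (by nlinarith [sq_nonneg ‖x‖]))
  have hD := integral_hardyFieldDeriv_mul w
  have hdw : ∀ j ∈ Finset.univ, Integrable fun x => 2 * ‖∂_{stdVec j} w x‖ ^ 2 :=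
    fun j _ => (integrable_norm_sq (∂_{stdVec j} w)).const_mul 2
  have h1 : ∫ x : R3, (1 + ‖x‖ ^ 2)⁻¹ * ‖w x‖ ^ 2 ≤
      ∫ x, ∑ j, hardyFieldDeriv j x * ‖w x‖ ^ 2 := by
    refine integral_mono hint (integrable_finsetSum _ fun j _ => (hD j).1) fun x => ?_
    simp only
    rw [← Finset.sum_mul]
    gcongr
    exact inv_le_sum_hardyFieldDeriv x
  have hneg : ∀ j ∈ Finset.univ, Integrable fun x =>
      -(2 * (hardyField j x * inner ℝ (w x) (∂_{stdVec j} w x))) := fun j _ => (hD j).2.1.neg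
  have h2 : ∫ x, ∑ j, -(2 * (hardyField j x * inner ℝ (w x) (∂_{stdVec j} w x))) ≤
      ∫ x, (2⁻¹ * ((1 + ‖x‖ ^ 2)⁻¹ * ‖w x‖ ^ 2) + ∑ j, 2 * ‖∂_{stdVec j} w x‖ ^ 2) := by
    refine integral_mono (integrable_finsetSum _ hneg)
      ((hint.const_mul _).add (integrable_finsetSum _ hdw)) fun x => ?_
    -- Young's inequality is weighted so that, after summation over `j`, exactly half of the left
    -- side of Hardy's inequality is absorbed; the remaining factor 2 then becomes 4.
    have hx : ∀ j, -(2 * (hardyField j x * inner ℝ (w x) (∂_{stdVec j} w x))) ≤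
        2⁻¹ * (hardyField j x ^ 2 * ‖w x‖ ^ 2) + 2 * ‖∂_{stdVec j} w x‖ ^ 2 := by
      intro j
      have := abs_real_inner_le_norm (w x) (∂_{stdVec j} w x)
      have h3 : |hardyField j x * inner ℝ (w x) (∂_{stdVec j} w x)| ≤
          |hardyField j x| * (‖w x‖ * ‖∂_{stdVec j} w x‖) := by
        rw [abs_mul]; gcongr
      have h4 := neg_abs_le (hardyField j x * inner ℝ (w x) (∂_{stdVec j} w x))
      have h5 : 0 ≤ (|hardyField j x| * ‖w x‖ - 2 * ‖∂_{stdVec j} w x‖) ^ 2 := sq_nonneg _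
      rw [← sq_abs (hardyField j x)]
      nlinarith
    refine (Finset.sum_le_sum fun j _ => hx j).trans ?_
    rw [Finset.sum_add_distrib, ← Finset.mul_sum, ← Finset.sum_mul]
    gcongr
    exact sum_hardyField_sq_le x
  rw [integral_finsetSum _ fun j _ => (hD j).1, Finset.sum_congr rfl fun j _ => (hD j).2.2] at h1
  rw [integral_finsetSum _ hneg,
    integral_add (hint.const_mul _) (integrable_finsetSum _ hdw), integral_const_mul,
    integral_finsetSum _ hdw] at h2
  simp only [integral_neg] at h2
  simp only [integral_const_mul, Finset.sum_neg_distrib, ← Finset.mul_sum] at h1 h2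
  linarith

end Hardy

/-! ### Squaring the Dirac equation -/

noncomputable section Dirac

open FourierTransform Laplacian Real Filter Topology ContDiff

theorem pauli_anticomm (j k : Fin 3) :
    pauli j * pauli k + pauli k * pauli j = if j = k then (2 : ℂ) • 1 else 0 := by
  fin_cases j <;> fin_cases k <;> ext a b <;> fin_cases a <;> fin_cases b <;>
    simp [pauli] <;> norm_num

/-- A product of two off-diagonal block matrices is block diagonal with Pauli products as blocks, so
the Clifford relation is inherited from the Pauli matrices. -/
theorem diracAlpha_anticomm (j k : Fin 3) :
    diracAlpha j * diracAlpha k + diracAlpha k * diracAlpha j =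
      if j = k then (2 : ℂ) • 1 else 0 := by
  have h : ∀ A B : Matrix (Fin 2 ⊕ Fin 2) (Fin 2 ⊕ Fin 2) ℂ,
      Matrix.reindex finSumFinEquiv finSumFinEquiv A * Matrix.reindex finSumFinEquiv finSumFinEquiv B
        = Matrix.reindex finSumFinEquiv finSumFinEquiv (A * B) := fun A B => by
    simp [Matrix.submatrix_mul_equiv]
  have hadd : ∀ A B : Matrix (Fin 2 ⊕ Fin 2) (Fin 2 ⊕ Fin 2) ℂ,
      Matrix.reindex finSumFinEquiv finSumFinEquiv A + Matrix.reindex finSumFinEquiv finSumFinEquiv B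
        = Matrix.reindex finSumFinEquiv finSumFinEquiv (A + B) := fun A B => rfl
  rw [diracAlpha, diracAlpha, h, h, hadd, Matrix.fromBlocks_multiply, Matrix.fromBlocks_multiply,
    Matrix.fromBlocks_add]
  simp only [zero_mul, mul_zero, zero_add, add_zero, pauli_anticomm]
  split_ifs
  · rw [show (0 : Matrix (Fin 2) (Fin 2) ℂ) = (2 : ℂ) • 0 by simp, ← Matrix.fromBlocks_smul,
      Matrix.fromBlocks_one]
    ext a b
    simp [Matrix.one_apply]
  · simp

/-- The Dirac matrix `αⱼ` acting on spinors. -/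
def alphaCLM (j : Fin 3) : C4 →L[ℂ] C4 :=
  Matrix.toEuclideanCLM (n := Fin 4) (𝕜 := ℂ) (diracAlpha j)

theorem alphaCLM_anticomm (j k : Fin 3) (z : C4) :
    alphaCLM j (alphaCLM k z) + alphaCLM k (alphaCLM j z) = if j = k then (2 : ℂ) • z else 0 := by
  have h := congrArg (fun A => Matrix.toEuclideanCLM (n := Fin 4) (𝕜 := ℂ) A z)
    (diracAlpha_anticomm j k)
  simp only [map_add, map_mul] at h
  rw [alphaCLM, alphaCLM]
  refine h.trans ?_
  split_ifs
  · rw [map_smul, map_one]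
    rfl
  · simp

theorem lineDeriv_comm (v : 𝓢(R3, ℂ)) (j k : Fin 3) :
    ∂_{stdVec j} (∂_{stdVec k} v) = ∂_{stdVec k} (∂_{stdVec j} v) := by
  have hinj : Function.Injective (𝓕 : 𝓢(R3, ℂ) → 𝓢(R3, ℂ)) := fun a b hab => by
    simpa using congrArg (𝓕⁻ : 𝓢(R3, ℂ) → 𝓢(R3, ℂ)) hab
  apply hinj
  ext ξ
  simp only [fourier_lineDeriv_apply]
  ring

/-- If `(α · D) T + G = 0`, then `-Δ T = (α · D)² T = -(α · D) G`; this is the resulting formula for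
`Δ T`, tested against `v`. -/
theorem apply_laplacian_of_freeDirac_add_eq_zero {T G : 𝓢'(R3, C4)} (h : freeDirac T + G = 0)
    (v : 𝓢(R3, ℂ)) :
    T (Δ v) = Complex.I • ∑ k : Fin 3, alphaCLM k (G (∂_{stdVec k} v)) := by
  have h1 : ∀ ψ : 𝓢(R3, ℂ), ∑ j : Fin 3, alphaCLM j (T (∂_{stdVec j} ψ)) = Complex.I • G ψ := by
    intro ψ
    have h2 : (freeDirac T + G) ψ = 0 := by rw [h]; rfl
    have h3 : freeDirac T ψ = ∑ j : Fin 3, alphaCLM j ((1 / Complex.I) • -T (∂_{stdVec j} ψ)) := by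
      rw [freeDirac, sum_apply]
      refine Finset.sum_congr rfl fun j _ => ?_
      rw [← map_neg]
      rfl
    have h4 : freeDirac T ψ + G ψ = 0 := h2
    have h5 : G ψ = -freeDirac T ψ := by rw [eq_neg_iff_add_eq_zero, add_comm, h4]
    rw [h5, h3, ← Finset.sum_neg_distrib, Finset.smul_sum]
    refine Finset.sum_congr rfl fun j _ => ?_
    simp only [map_smul, map_neg, smul_neg, neg_neg, smul_smul,
      mul_one_div_cancel Complex.I_ne_zero, one_smul]
  have h2 : ∀ k, alphaCLM k (Complex.I • G (∂_{stdVec k} v)) =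
      ∑ j : Fin 3, alphaCLM k (alphaCLM j (T (∂_{stdVec j} (∂_{stdVec k} v)))) := fun k => by
    rw [← h1, map_sum]
  have h3 : Complex.I • ∑ k : Fin 3, alphaCLM k (G (∂_{stdVec k} v)) =
      ∑ k : Fin 3, ∑ j : Fin 3, alphaCLM k (alphaCLM j (T (∂_{stdVec j} (∂_{stdVec k} v)))) := by
    rw [Finset.smul_sum]
    refine Finset.sum_congr rfl fun k _ => ?_
    rw [← h2, map_smul]
  have h4 : ∑ k : Fin 3, ∑ j : Fin 3, alphaCLM k (alphaCLM j (T (∂_{stdVec j} (∂_{stdVec k} v)))) =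
      ∑ k : Fin 3, ∑ j : Fin 3, alphaCLM j (alphaCLM k (T (∂_{stdVec j} (∂_{stdVec k} v)))) := by
    rw [Finset.sum_comm]
    refine Finset.sum_congr rfl fun j _ => Finset.sum_congr rfl fun k _ => ?_
    rw [lineDeriv_comm]
  -- Averaging the two orderings of the double sum turns `αₖαⱼ` into an anticommutator, and only the
  -- diagonal terms survive.
  have h5 : (2 : ℂ) • (Complex.I • ∑ k : Fin 3, alphaCLM k (G (∂_{stdVec k} v))) =
      (2 : ℂ) • T (Δ v) := by
    rw [h3, two_smul]
    nth_rewrite 2 [h4]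
    rw [← Finset.sum_add_distrib]
    simp_rw [← Finset.sum_add_distrib, alphaCLM_anticomm]
    simp only [Finset.sum_ite_eq, Finset.mem_univ, if_true]
    rw [laplacian_eq_sum_stdVec, map_sum, Finset.smul_sum]
  exact (smul_right_injective C4 (two_ne_zero (α := ℂ)) h5).symm

/-! ### From a bounded functional to an `L²` function -/

theorem integrable_schwartz_smul (φ : 𝓢(R3, ℂ)) {f : R3 → C4} (hf : MemLp f 2 volume) :
    Integrable fun x => φ x • f x :=
  memLp_one_iff_integrable.1 (hf.smul (φ.memLp 2 volume))

/-- A tempered distribution which is bounded for the `L²` norm is an `L²` function. -/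
theorem exists_Lp_eq_of_norm_le (T : 𝓢'(R3, C4)) (C : ℝ)
    (h : ∀ φ : 𝓢(R3, ℂ), ‖T φ‖ ≤ C * √(∫ x, ‖φ x‖ ^ 2)) :
    ∃ F : Lp C4 2 (volume : Measure R3), T = F := by
  set e : 𝓢(R3, ℂ) →ₗ[ℂ] Lp ℂ 2 (volume : Measure R3) :=
    (SchwartzMap.toLpCLM ℂ ℂ 2 (volume : Measure R3)).toLinearMap
  have he : ∀ φ : 𝓢(R3, ℂ), ‖e φ‖ = √(∫ x, ‖φ x‖ ^ 2) := by
    intro φ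
    change ‖φ.toLp 2 volume‖ = _
    rw [SchwartzMap.norm_toLp' (by norm_num) (by norm_num), Real.sqrt_eq_rpow]
    simp
  have hdense : DenseRange e := SchwartzMap.denseRange_toLpCLM (by norm_num)
  have hcomp : ∀ i : Fin 4, ∃ y : Lp ℂ 2 (volume : Measure R3), ∀ φ : 𝓢(R3, ℂ),
      (T φ) i = ∫ x, φ x * star (y x) := by
    intro i
    set l : 𝓢(R3, ℂ) →ₗ[ℂ] ℂ := (EuclideanSpace.proj i : C4 →L[ℂ] ℂ).toLinearMap ∘ₗ T.toLinearMap
    have hl : ∃ C, ∀ φ, ‖l φ‖ ≤ C * ‖e φ‖ := ⟨C, fun φ => by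
      rw [he]
      exact (PiLp.norm_apply_le (T φ) i).trans (h φ)⟩
    -- Each component extends from the dense Schwartz functions to `L²`, and Riesz represents it;
    -- the inner product is conjugate-linear in the representing vector, whence the `star`.
    refine ⟨(InnerProductSpace.toDual ℂ _).symm (l.extendOfNorm e), fun φ => ?_⟩
    have h1 : l φ = l.extendOfNorm e (e φ) := (LinearMap.extendOfNorm_eq hdense hl φ).symm
    change l φ = _
    rw [h1, ← InnerProductSpace.toDual_symm_apply, L2.inner_def]
    refine integral_congr_ae ?_
    filter_upwards [φ.coeFn_toLp 2 volume] with x hx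
    change inner ℂ _ (φ.toLp 2 volume x) = _
    rw [hx, RCLike.inner_apply]
    rfl
  choose y hy using hcomp
  have hF : MemLp (fun x => WithLp.toLp 2 fun i => star (y i x) : R3 → C4) 2 volume :=
    memLp_piLp_iff.2 fun i => (Lp.memLp (y i)).star
  refine ⟨hF.toLp _, ?_⟩
  ext φ i
  rw [hy, Lp.toTemperedDistribution_apply]
  have h2 : ∫ x, φ x • (hF.toLp _ : R3 → C4) x = ∫ x, φ x • (WithLp.toLp 2 fun i => star (y i x) : C4) := by
    refine integral_congr_ae ?_
    filter_upwards [hF.coeFn_toLp] with x hx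
    rw [hx]
  rw [h2]
  exact ((EuclideanSpace.proj i : C4 →L[ℂ] ℂ).integral_comp_comm
    (integrable_schwartz_smul φ hF))

/-- Both sides are locally integrable, so agreement on smooth compactly supported functions forces
equality almost everywhere. -/
theorem MemWeightedL2.memLp_of_toDist_eq {σ : ℝ} {f : R3 → C4} (hf : MemWeightedL2 σ f)
    {F : Lp C4 2 (volume : Measure R3)} (h : hf.toDist = F) : MemLp f 2 volume := by
  have hloc : LocallyIntegrable f := by
    have h1 : LocallyIntegrable fun x => (bracket x ^ σ) • f x :=
      MemLp.locallyIntegrable hf (by norm_num)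
    have hc : Continuous fun x => bracket x ^ (-σ) :=
      continuous_bracket.rpow_const fun x => Or.inl (bracket_pos x).ne'
    refine (h1.continuous_smul hc).congr (Eventually.of_forall fun x => ?_)
    change bracket x ^ (-σ) • bracket x ^ σ • f x = f x
    rw [smul_smul, ← Real.rpow_add (bracket_pos x), neg_add_cancel, Real.rpow_zero, one_smul]
  have hF : LocallyIntegrable (F : R3 → C4) := (Lp.memLp F).locallyIntegrable (by norm_num)
  have hae : ∀ᵐ x, f x = F x := by
    refine ae_eq_of_integral_contDiff_smul_eq hloc hF fun g g_smooth g_cpt => ?_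
    have hg₁ : HasCompactSupport (Complex.ofRealCLM ∘ g) := g_cpt.comp_left rfl
    have hg₂ : ContDiff ℝ ∞ (Complex.ofRealCLM ∘ g) := by fun_prop
    have h3 := congrArg (fun S : 𝓢'(R3, C4) => S (hg₁.toSchwartzMap hg₂)) h
    simpa [hf.toDist_apply] using h3
  exact (Lp.memLp F).ae_eq (hae.mono fun x hx => hx.symm)

/-! ### The `L²` bound from the decay of `Q` -/

theorem norm_potentialMul_le {Q : R3 → Matrix (Fin 4) (Fin 4) ℂ} {ρ C : ℝ}
    (hQ : ∀ x j k, ‖Q x j k‖ ≤ C * bracket x ^ (-ρ)) (f : R3 → C4) (x : R3) :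
    ‖potentialMul Q f x‖ ^ 2 ≤ 64 * C ^ 2 * (bracket x ^ (-ρ)) ^ 2 * ‖f x‖ ^ 2 := by
  have hj : ∀ j, ‖potentialMul Q f x j‖ ≤ 4 * (C * bracket x ^ (-ρ) * ‖f x‖) := by
    intro j
    have e : potentialMul Q f x j = ∑ k, Q x j k * f x k := by
      simp [potentialMul, Matrix.mulVec, dotProduct]
    rw [e]
    refine (norm_sum_le_of_le (f := fun k => Q x j k * f x k)
      (n := fun _ => C * bracket x ^ (-ρ) * ‖f x‖) _ fun k _ => ?_).trans (by simp)
    rw [norm_mul]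
    exact mul_le_mul (hQ x j k) (PiLp.norm_apply_le (f x) k) (norm_nonneg _)
      ((norm_nonneg _).trans (hQ x j k))
  rw [EuclideanSpace.norm_sq_eq]
  have : ∀ j ∈ Finset.univ, ‖potentialMul Q f x j‖ ^ 2 ≤ (4 * (C * bracket x ^ (-ρ) * ‖f x‖)) ^ 2 :=
    fun j _ => pow_le_pow_left₀ (norm_nonneg _) (hj j) 2
  -- The constant is `64 = 4 · 4²`: four components, each a sum of four entries.
  refine (Finset.sum_le_sum this).trans (le_of_eq ?_)
  simp only [Finset.sum_const, Finset.card_univ, Fintype.card_fin, nsmul_eq_mul]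
  push_cast
  ring

/-- The integrand is at most a constant times `⟨x⟩^(2 - 2ρ)|f|²`, and `2 - 2ρ ≤ -2s` is the
condition `s ≤ ρ - 1`. -/
theorem integrable_bracket_sq_mul_potentialMul {Q : R3 → Matrix (Fin 4) (Fin 4) ℂ} {ρ s : ℝ}
    (hQ : PotentialAssumption Q ρ) (hs : s ≤ ρ - 1) {f : R3 → C4} (hf : MemWeightedL2 (-s) f) :
    Integrable fun x => (1 + ‖x‖ ^ 2) * ‖potentialMul Q f x‖ ^ 2 := by
  obtain ⟨C, hC, hd⟩ := hQ.decay
  have h1 : Integrable fun x => bracket x ^ (2 - 2 * ρ) * ‖f x‖ ^ 2 := hf.integrable (by linarith)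
  refine (h1.const_mul (64 * C ^ 2)).mono' ?_ (Eventually.of_forall fun x => ?_)
  · have hc : Continuous fun x : R3 => 1 + ‖x‖ ^ 2 := by fun_prop
    exact hc.aestronglyMeasurable.mul ((hf.potentialMul hQ).aestronglyMeasurable.norm.pow 2)
  · have hb := bracket_pos x
    rw [Real.norm_of_nonneg (by positivity), ← bracket_sq]
    calc bracket x ^ 2 * ‖potentialMul Q f x‖ ^ 2 ≤
        bracket x ^ 2 * (64 * C ^ 2 * (bracket x ^ (-ρ)) ^ 2 * ‖f x‖ ^ 2) := by
          gcongr
          exact norm_potentialMul_le hd f x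
      _ = 64 * C ^ 2 * ((bracket x ^ 2 * (bracket x ^ (-ρ)) ^ 2) * ‖f x‖ ^ 2) := by ring
      _ = 64 * C ^ 2 * (bracket x ^ (2 - 2 * ρ) * ‖f x‖ ^ 2) := by
          congr 2
          rw [← Real.rpow_natCast (bracket x) 2, ← Real.rpow_mul_natCast hb.le,
            ← Real.rpow_add hb]
          congr 1
          push_cast
          ring

/-- Pairing with a weighted `L²` function is bounded on derivatives of solutions. -/
theorem norm_apply_deriv_le {σ : ℝ} {g : R3 → C4} (hg : MemWeightedL2 σ g)
    (hi : Integrable fun x => (1 + ‖x‖ ^ 2) * ‖g x‖ ^ 2) {ε : ℝ} {v φ : 𝓢(R3, ℂ)}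
    (h : ∀ ξ, ((ε ^ 2 + ‖ξ‖ ^ 2 : ℝ) : ℂ) * 𝓕 v ξ = 𝓕 φ ξ) (k : Fin 3) :
    ‖hg.toDist (∂_{stdVec k} v)‖ ≤ √(∫ x, (1 + ‖x‖ ^ 2) * ‖g x‖ ^ 2) * √(12 * (2 * π) ^ 4) *
      √(∫ x, ‖φ x‖ ^ 2) := by
  rw [hg.toDist_apply]
  have hc : Continuous fun x : R3 => (1 + ‖x‖ ^ 2)⁻¹ :=
    (by fun_prop : Continuous fun x : R3 => 1 + ‖x‖ ^ 2).inv₀ fun x => by positivity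
  have hint : Integrable fun x : R3 => (1 + ‖x‖ ^ 2)⁻¹ * ‖∂_{stdVec k} v x‖ ^ 2 := by
    refine (integrable_norm_sq (∂_{stdVec k} v)).mono'
      (hc.mul ((∂_{stdVec k} v).continuous.norm.pow 2)).aestronglyMeasurable
      (Eventually.of_forall fun x => ?_)
    rw [Real.norm_of_nonneg (by positivity)]
    exact mul_le_of_le_one_left (by positivity)
      (inv_le_one_of_one_le₀ (by nlinarith [sq_nonneg ‖x‖]))
  have key := norm_integral_smul_le (fun x => by positivity) hc (∂_{stdVec k} v).continuous
    hg.aestronglyMeasurable hint (by simpa only [inv_inv] using hi)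
  simp only [inv_inv] at key
  refine key.trans ?_
  rw [mul_comm, mul_assoc, ← Real.sqrt_mul (by positivity : (0 : ℝ) ≤ 12 * (2 * π) ^ 4)]
  refine mul_le_mul_of_nonneg_left (Real.sqrt_le_sqrt ?_) (Real.sqrt_nonneg _)
  -- Hardy's constant 4 times the three directions gives the 12.
  refine (hardy_inequality _).trans ?_
  have : ∑ j : Fin 3, ∫ x, ‖∂_{stdVec j} (∂_{stdVec k} v) x‖ ^ 2 ≤
      ∑ _j : Fin 3, (2 * π) ^ 4 * ∫ x, ‖φ x‖ ^ 2 :=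
    Finset.sum_le_sum fun j _ => integral_norm_sq_deriv_deriv_le h j k
  simp only [Finset.sum_const, Finset.card_univ, Fintype.card_fin, nsmul_eq_mul] at this
  push_cast at this
  linarith

theorem exists_norm_toDist_le {Q : R3 → Matrix (Fin 4) (Fin 4) ℂ} {ρ s : ℝ}
    (hQ : PotentialAssumption Q ρ) (hs : s ≤ 3 / 2) (hsρ : s ≤ ρ - 1) {f : R3 → C4}
    (hf : MemWeightedL2 (-s) f) (h : diracDist hQ hf = 0) :
    ∃ C, ∀ φ : 𝓢(R3, ℂ), ‖hf.toDist φ‖ ≤ C * √(∫ x, ‖φ x‖ ^ 2) := by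
  set D := √(∫ x, (1 + ‖x‖ ^ 2) * ‖potentialMul Q f x‖ ^ 2) * √(12 * (2 * π) ^ 4)
  -- The constant is free of `ε`; only the error `δ` dictates the choice of `ε`, and `δ` is
  -- arbitrary for each fixed `φ`.
  refine ⟨((2 * π) ^ 2)⁻¹ * ∑ k, ‖alphaCLM k‖ * D, fun φ => le_of_forall_pos_le_add fun δ hδ => ?_⟩
  obtain ⟨ε, hε, hsmall⟩ := resolvent_pairing_small hs hf φ hδ
  obtain ⟨v, hv⟩ := exists_resolvent hε φ
  have h1 : hf.toDist φ = ((ε : ℂ) ^ 2) • hf.toDist v - (((2 * π : ℂ) ^ 2)⁻¹) • (Complex.I •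
      ∑ k : Fin 3, alphaCLM k ((hf.potentialMul hQ).toDist (∂_{stdVec k} v))) := by
    rw [← apply_laplacian_of_freeDirac_add_eq_zero h, ← map_smul, ← map_smul, ← map_sub,
      resolvent_equation hv]
  have h2 : ‖((ε : ℂ) ^ 2) • hf.toDist v‖ ≤ δ := by
    rw [norm_smul, norm_pow, Complex.norm_real, Real.norm_of_nonneg hε.le, hf.toDist_apply]
    exact hsmall v hv
  have h3 : ‖∑ k : Fin 3, alphaCLM k ((hf.potentialMul hQ).toDist (∂_{stdVec k} v))‖ ≤
      (∑ k, ‖alphaCLM k‖ * D) * √(∫ x, ‖φ x‖ ^ 2) := by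
    rw [Finset.sum_mul]
    refine norm_sum_le_of_le _ fun k _ => ((alphaCLM k).le_opNorm _).trans ?_
    rw [mul_assoc]
    gcongr
    exact norm_apply_deriv_le (hf.potentialMul hQ)
      (integrable_bracket_sq_mul_potentialMul hQ hsρ hf) hv k
  rw [h1]
  refine (norm_sub_le _ _).trans ?_
  rw [add_comm]
  refine add_le_add ?_ h2
  rw [norm_smul, norm_smul, Complex.norm_I, one_mul, mul_assoc]
  have h4 : ‖((2 * π : ℂ) ^ 2)⁻¹‖ = ((2 * π) ^ 2)⁻¹ := by
    rw [norm_inv, norm_pow, norm_mul, Complex.norm_real, Real.norm_of_nonneg Real.pi_pos.le]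
    simp
  rw [h4]
  gcongr

/-! ### Sobolev regularity and conclusion -/

theorem memSobolev_postcomp {r : ℝ} {u : 𝓢'(R3, C4)} (hu : MemSobolev r 2 u) (A : C4 →L[ℂ] C4) :
    MemSobolev r 2 (PointwiseConvergenceCLM.postcomp _ A u) := by
  obtain ⟨F, hF⟩ := hu
  refine ⟨A.compLp F, ?_⟩
  have h1 : besselPotential R3 C4 r (PointwiseConvergenceCLM.postcomp _ A u) =
      PointwiseConvergenceCLM.postcomp _ A (besselPotential R3 C4 r u) := by
    ext φ : 1
    rfl
  rw [h1, hF]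
  ext φ : 1
  change A ((F : 𝓢'(R3, C4)) φ) = _
  rw [Lp.toTemperedDistribution_apply, Lp.toTemperedDistribution_apply,
    ← A.integral_comp_comm (integrable_schwartz_smul φ (Lp.memLp F))]
  refine integral_congr_ae ?_
  filter_upwards [A.coeFn_compLp F] with x hx
  rw [hx, map_smul]

theorem besselPotential_two (u : 𝓢'(R3, C4)) :
    besselPotential R3 C4 2 u = u - (((2 * π) ^ 2)⁻¹ : ℝ) • Δ u := by
  have e : (fun x : R3 => (((1 + ‖x‖ ^ 2) ^ ((2 : ℝ) / 2) : ℝ) : ℂ)) =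
      (fun _ => (1 : ℂ)) + fun x : R3 => ((‖x‖ ^ 2 : ℝ) : ℂ) := by
    funext x
    simp
  rw [TemperedDistribution.laplacian_eq_fourierMultiplierCLM, besselPotential, e,
    fourierMultiplierCLM_apply, smulLeftCLM_add (by fun_prop) (by fun_prop), add_apply,
    smulLeftCLM_const, one_smul, FourierTransform.fourierInv_add,
    FourierTransform.fourierInv_fourier_eq, ← fourierMultiplierCLM_apply, smul_smul, mul_neg,
    inv_mul_cancel₀ (by positivity), neg_smul, one_smul, sub_neg_eq_add]

/-- `ΔT` is a combination of first derivatives of `G ∈ L²`, hence in `H⁻¹`, as is `T` itself. So the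
Bessel potential of order 2, which is `1 - (2π)⁻²Δ`, sends `T` into `H⁻¹`, and inverting it gains
two orders. -/
theorem memSobolev_one_of_freeDirac {T G : 𝓢'(R3, C4)} (h : freeDirac T + G = 0)
    (hT : MemSobolev 0 2 T) (hG : MemSobolev 0 2 G) : MemSobolev 1 2 T := by
  have hΔ : Δ T = -Complex.I • ∑ k : Fin 3,
      PointwiseConvergenceCLM.postcomp _ (alphaCLM k) (∂_{stdVec k} G) := by
    ext φ : 1
    rw [TemperedDistribution.laplacian_apply_apply, apply_laplacian_of_freeDirac_add_eq_zero h]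
    change _ = -Complex.I • (∑ k : Fin 3,
      PointwiseConvergenceCLM.postcomp _ (alphaCLM k) (∂_{stdVec k} G)) φ
    rw [sum_apply, neg_smul, ← smul_neg, ← Finset.sum_neg_distrib]
    congr 1
    refine Finset.sum_congr rfl fun k _ => ?_
    change _ = -alphaCLM k (G (-∂_{stdVec k} φ))
    rw [map_neg, map_neg, neg_neg]
  have h0 : ∀ k, MemSobolev (-1) 2
      (PointwiseConvergenceCLM.postcomp _ (alphaCLM k) (∂_{stdVec k} G)) := fun k => by
    have := memSobolev_postcomp (hG.lineDerivOp (m := stdVec k)) (alphaCLM k)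
    rwa [zero_sub] at this
  have h1 : MemSobolev (-1) 2 (Δ T) := by
    rw [hΔ, Fin.sum_univ_three]
    exact (((h0 0).add (h0 1)).add (h0 2)).smul _
  have h2 : MemSobolev (-1) 2 (besselPotential R3 C4 2 T) := by
    rw [besselPotential_two]
    exact (hT.mono (by norm_num)).sub (h1.smul ((((2 * π) ^ 2)⁻¹ : ℝ) : ℂ))
  rw [memSobolev_besselPotential_iff] at h2
  norm_num at h2
  exact h2

theorem memLp_of_diracDist_eq_zero {Q : R3 → Matrix (Fin 4) (Fin 4) ℂ} {ρ s : ℝ}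
    (hQ : PotentialAssumption Q ρ) (hs : s ≤ 3 / 2) (hsρ : s ≤ ρ - 1) {f : R3 → C4}
    (hf : MemWeightedL2 (-s) f) (h : diracDist hQ hf = 0) : MemLp f 2 volume := by
  obtain ⟨C, hC⟩ := exists_norm_toDist_le hQ hs hsρ hf h
  obtain ⟨F, hF⟩ := exists_Lp_eq_of_norm_le _ C hC
  exact hf.memLp_of_toDist_eq hF

theorem MemWeightedL2.memSobolev_zero {σ : ℝ} {f : R3 → C4} (hf : MemWeightedL2 σ f)
    (h : MemLp f 2 volume) : MemSobolev 0 2 hf.toDist := by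
  refine memSobolev_zero_iff.2 ⟨h.toLp f, ?_⟩
  ext φ : 1
  rw [hf.toDist_apply, Lp.toTemperedDistribution_apply]
  refine integral_congr_ae ?_
  filter_upwards [h.coeFn_toLp] with x hx
  rw [hx]

theorem memH1_of_diracDist_eq_zero {Q : R3 → Matrix (Fin 4) (Fin 4) ℂ} {ρ s : ℝ}
    (hQ : PotentialAssumption Q ρ) (hs : s ≤ 3 / 2) (hsρ : s ≤ ρ - 1) {f : R3 → C4}
    (hf : MemWeightedL2 (-s) f) (h : diracDist hQ hf = 0) : hf.MemH1 := by
  have hL := memLp_of_diracDist_eq_zero hQ hs hsρ hf h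
  -- With weight exponent 0, boundedness of `Q` puts `Qf` in `L²`.
  have hf0 : MemWeightedL2 0 f := by simpa [MemWeightedL2] using hL
  have hQf : MemLp (potentialMul Q f) 2 volume := by
    simpa [MemWeightedL2] using hf0.potentialMul hQ
  exact memSobolev_one_of_freeDirac h (hf.memSobolev_zero hL)
    ((hf.potentialMul hQ).memSobolev_zero hQf)

end Dirac

theorem theorem2p2 (Q : R3 → Matrix (Fin 4) (Fin 4) ℂ) (ρ : ℝ)
    (hQ : PotentialAssumption Q ρ) (hρ : 3 / 2 < ρ) :
    (∀ (s : ℝ) (f : R3 → C4), 0 < s → s ≤ min (3 / 2) (ρ - 1) →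
      ∀ hf : MemWeightedL2 (-s) f, diracDist hQ hf = 0 → hf.MemH1) ∧
    ¬ ∃ (s : ℝ) (f : R3 → C4), 0 < s ∧ s ≤ min (3 / 2) (ρ - 1) ∧ IsZeroResonance hQ s f := by
  refine ⟨fun s f _ hs hf h => ?_, ?_⟩
  · exact memH1_of_diracDist_eq_zero hQ (hs.trans (min_le_left _ _)) (hs.trans (min_le_right _ _))
      hf h
  · rintro ⟨s, f, -, hs, hf, hn, h⟩
    exact hn (memLp_of_diracDist_eq_zero hQ (hs.trans (min_le_left _ _))
      (hs.trans (min_le_right _ _)) hf h)
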